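/- Let $E$ and $F$ be complex Banach spaces, let $U\subseteq E$ be open, let $1<p\le\infty$ and let $p^*$ be the conjugate index of $p$ ($1/p+1/p^*=1$, $p^*=1$ if $p=\infty$). Let $\mathcal{H}^\infty(U,F)$ be the space of bounded holomorphic mappings from $U$ to $F$ with the supremum norm, let $\mathcal{H}^\infty(U)=\mathcal{H}^\infty(U,\mathbb{C})$, and let $\mathcal{G}^\infty(U)$ be the norm-closed linear hull in $\mathcal{H}^\infty(U)^*$ of the evaluation functionals $\delta(x)$, $x\in U$. For $f\in\mathcal{H}^\infty(U,F)$ let $T_f\colon\mathcal{G}^\infty(U)\to F$ be Mujica's linearization of $f$, that is, the unique bounded linear operator with $T_f(\delta(x))=f(x)$ for all $x\in U$. For $y_1^*,\dots,y_n^*\in F^*$ write $w_{p^*}(y_1^*,\dots,y_n^*)=\sup_{y^{**}\in B_{F^{**}}}\|(y^{**}(y_i^*))_{i=1}^n\|_{\ell_{p^*}^n}$, where $B_{F^{**}}$ is the closed unit ball of the bidual $F^{**}$. A bounded linear operator $T\colon X\to F$ on a complex Banach space $X$ is *strongly $p$-summing* if there is a constant $C\ge 0$ such that for all $n\in\mathbb{N}$,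 $x_1,\dots,x_n\in X$ and $y_1^*,\dots,y_n^*\in F^*$, $$\sum_{i=1}^n|\langle y_i^*,T(x_i)\rangle|\le C\,\|(\|x_i\|)_{i=1}^n\|_{\ell_p^n}\,w_{p^*}(y_1^*,\dots,y_n^*);$$ $d_p(T)$ is the infimum of such $C$, and $\mathcal{D}_p(X,F)$ is the space of these operators. A holomorphic mapping $f\colon U\to F$ is *Cohen strongly $p$-summing* if there is a constant $C\ge 0$ such that for all $n\in\mathbb{N}$, $\lambda_1,\dots,\lambda_n\in\mathbb{C}$, $x_1,\dots,x_n\in U$ and $y_1^*,\dots,y_n^*\in F^*$, $$\sum_{i=1}^n|\lambda_i|\,|\langle y_i^*,f(x_i)\rangle|\le C\,\|(\lambda_i)_{i=1}^n\|_{\ell_p^n}\,w_{p^*}(y_1^*,\dots,y_n^*);$$ $d_p^{\mathcal{H}^\infty}(f)$ is the infimum of such $C$, and $\mathcal{D}_p^{\mathcal{H}^\infty}(U,F)$ is the space of these mappings (which are all bounded). **Theorem.** Let $f\in\mathcal{H}^\infty(U,F)$. Then $f$ is Cohen strongly $p$-summing holomorphic if and only if $T_f\colon\mathcal{G}^\infty(U)\to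 F$ is strongly $p$-summing. In this case, $d_p(T_f)=d_p^{\mathcal{H}^\infty}(f)$. Furthermore, the mapping $f\mapsto T_f$ is an isometric (linear) isomorphism from $(\mathcal{D}_p^{\mathcal{H}^\infty}(U,F),d_p^{\mathcal{H}^\infty})$ onto $(\mathcal{D}_p(\mathcal{G}^\infty(U),F),d_p)$. -/

import Mathlib

open scoped ENNReal BoundedContinuousFunction
open TopologicalSpace

noncomputable section

set_option linter.unusedSectionVars false

/-! ### Bounded holomorphic mappings -/

section HInf

variable {E : Type*} {F : Type*} [NormedAddCommGroup E] [NormedSpace ℂ E]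
  [NormedAddCommGroup F] [NormedSpace ℂ F]

/-- A mapping `f : U → F` on an open set `U ⊆ E` is holomorphic if it is (complex) Fréchet
differentiable at every point of `U`. As `U` is open, the values off `U` of the function `g`
that extends `f` to `E` play no role. -/
def IsHolomorphic (U : Opens E) (f : U → F) : Prop :=
  ∃ g : E → F, DifferentiableOn ℂ g (U : Set E) ∧ ∀ x : U, g x = f x

theorem IsHolomorphic.continuous {U : Opens E} {f : U → F} (hf : IsHolomorphic U f) :
    Continuous f := by
  obtain ⟨g, hg, h⟩ := hf
  have : f = (U : Set E).domRestrict g := by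
    funext x
    exact (h x).symm
  rw [this]
  exact continuousOn_iff_continuous_domRestrict.1 hg.continuousOn

theorem IsHolomorphic.zero (U : Opens E) : IsHolomorphic U (0 : U → F) :=
  ⟨0, differentiableOn_const 0, fun _ => rfl⟩

theorem IsHolomorphic.add {U : Opens E} {f g : U → F} (hf : IsHolomorphic U f)
    (hg : IsHolomorphic U g) : IsHolomorphic U (f + g) := by
  obtain ⟨f', hf', h⟩ := hf
  obtain ⟨g', hg', h'⟩ := hg
  exact ⟨f' + g', hf'.add hg', fun x => by simp [h, h']⟩

theorem IsHolomorphic.smul {U : Opens E} {f : U → F} (c : ℂ) (hf : IsHolomorphic U f) :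
    IsHolomorphic U (c • f) := by
  obtain ⟨f', hf', h⟩ := hf
  exact ⟨c • f', hf'.const_smul c, fun x => by simp [h]⟩

theorem IsHolomorphic.clm_comp {G : Type*} [NormedAddCommGroup G] [NormedSpace ℂ G]
    {U : Opens E} {f : U → F} (T : F →L[ℂ] G) (hf : IsHolomorphic U f) :
    IsHolomorphic U (fun x => T (f x)) := by
  obtain ⟨f', hf', h⟩ := hf
  exact ⟨fun x => T (f' x), T.differentiable.comp_differentiableOn hf', fun x => by simp [h]⟩

/-- The bounded holomorphic mappings `U → F`, as a linear subspace of the space of bounded continuous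
mappings with the supremum norm. -/
def hInfSubmodule (U : Opens E) (F : Type*) [NormedAddCommGroup F] [NormedSpace ℂ F] :
    Submodule ℂ (U →ᵇ F) where
  carrier := {f | IsHolomorphic U (f : U → F)}
  zero_mem' := IsHolomorphic.zero U
  add_mem' hf hg := IsHolomorphic.add hf hg
  smul_mem' c _ hf := IsHolomorphic.smul c hf

/-- The space `H^∞(U, F)` of bounded holomorphic mappings `U → F`, with the supremum norm. -/
def HInf (U : Opens E) (F : Type*) [NormedAddCommGroup F] [NormedSpace ℂ F] : Type _ :=
  hInfSubmodule U F

namespace HInf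

instance (U : Opens E) : NormedAddCommGroup (HInf U F) :=
  inferInstanceAs (NormedAddCommGroup (hInfSubmodule U F))

instance (U : Opens E) : NormedSpace ℂ (HInf U F) :=
  inferInstanceAs (NormedSpace ℂ (hInfSubmodule U F))

/-- The mapping `U → F` that an element of `H^∞(U, F)` is. -/
def toFun {U : Opens E} (f : HInf U F) : U → F := f.1

theorem isHolomorphic {U : Opens E} (f : HInf U F) : IsHolomorphic U f.toFun := f.2

theorem norm_toFun_le {U : Opens E} (f : HInf U F) (x : U) : ‖f.toFun x‖ ≤ ‖f‖ :=
  (BoundedContinuousFunction.norm_le (f := f.1) (norm_nonneg f)).1 le_rfl x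

theorem norm_le {U : Opens E} (f : HInf U F) {C : ℝ} (h0 : 0 ≤ C) (h : ∀ x, ‖f.toFun x‖ ≤ C) :
    ‖f‖ ≤ C :=
  (BoundedContinuousFunction.norm_le (f := f.1) h0).2 h

/-- A bounded holomorphic mapping, as an element of `H^∞(U, F)`. -/
def mk {U : Opens E} (f : U → F) (hf : IsHolomorphic U f) (C : ℝ)
    (hC : ∀ x, ‖f x‖ ≤ C) : HInf U F :=
  ⟨BoundedContinuousFunction.ofNormedAddCommGroup f hf.continuous C hC, hf⟩

@[simp] theorem toFun_mk {U : Opens E} (f : U → F) (hf : IsHolomorphic U f) (C : ℝ)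
    (hC : ∀ x, ‖f x‖ ≤ C) : (mk f hf C hC).toFun = f := rfl

end HInf

/-- The evaluation functional `δ(x) ∈ H^∞(U)^*`, `δ(x)(f) = f(x)`. -/
def evalFunctional (U : Opens E) (x : U) : StrongDual ℂ (HInf U ℂ) :=
  LinearMap.mkContinuous
    { toFun := fun f => f.toFun x
      map_add' := fun _ _ => rfl
      map_smul' := fun _ _ => rfl } 1 fun f => by
    rw [one_mul]
    exact f.norm_toFun_le x

@[simp] theorem evalFunctional_apply (U : Opens E) (x : U) (f : HInf U ℂ) :
    evalFunctional U x f = f.toFun x := rfl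

/-- The norm-closed linear hull in `H^∞(U)^*` of the evaluation functionals. -/
def gInfSubmodule (U : Opens E) : Submodule ℂ (StrongDual ℂ (HInf U ℂ)) :=
  (Submodule.span ℂ (Set.range (evalFunctional U))).topologicalClosure

theorem mem_gInfSubmodule {U : Opens E} {φ : StrongDual ℂ (HInf U ℂ)}
    (h : φ ∈ Submodule.span ℂ (Set.range (evalFunctional U))) : φ ∈ gInfSubmodule U :=
  Submodule.le_topologicalClosure _ h

/-- The space `G^∞(U)`: the norm-closed linear hull in `H^∞(U)^*` of the evaluation functionals,
with the norm of `H^∞(U)^*`. -/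
def GInf (U : Opens E) : Type _ := gInfSubmodule U

namespace GInf

instance (U : Opens E) : NormedAddCommGroup (GInf U) :=
  inferInstanceAs (NormedAddCommGroup (gInfSubmodule U))

instance (U : Opens E) : NormedSpace ℂ (GInf U) :=
  inferInstanceAs (NormedSpace ℂ (gInfSubmodule U))

/-- An element of the closed linear hull of the evaluation functionals, as an element of
`G^∞(U)`. -/
def mk {U : Opens E} (φ : StrongDual ℂ (HInf U ℂ)) (h : φ ∈ gInfSubmodule U) : GInf U := ⟨φ, h⟩

/-- The functional on `H^∞(U)` that an element of `G^∞(U)` is. -/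
def toDual {U : Opens E} (γ : GInf U) : StrongDual ℂ (HInf U ℂ) := γ.1

theorem toDual_mem {U : Opens E} (γ : GInf U) : γ.toDual ∈ gInfSubmodule U := γ.2

theorem toDual_add {U : Opens E} (γ δ : GInf U) : (γ + δ).toDual = γ.toDual + δ.toDual := rfl

theorem toDual_smul {U : Opens E} (c : ℂ) (γ : GInf U) : (c • γ).toDual = c • γ.toDual := rfl

theorem norm_def {U : Opens E} (γ : GInf U) : ‖γ‖ = ‖γ.toDual‖ := rfl

end GInf

/-- The mapping `g_U : U → G^∞(U)`, `g_U(x) = δ(x)`. -/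
def gMap (U : Opens E) (x : U) : GInf U :=
  GInf.mk (evalFunctional U x) (mem_gInfSubmodule (Submodule.subset_span ⟨x, rfl⟩))

@[simp] theorem gMap_toDual (U : Opens E) (x : U) : (gMap U x).toDual = evalFunctional U x := rfl

/-! ### Mujica's linearization -/

/-- For `f ∈ H^∞(U, F)`, the operator `y* ↦ y* ∘ f` from `F^*` to `H^∞(U)`. -/
def HInf.transpose {U : Opens E} (f : HInf U F) : StrongDual ℂ F →L[ℂ] HInf U ℂ :=
  LinearMap.mkContinuous
    { toFun := fun y => HInf.mk (fun x => y (f.toFun x)) (f.isHolomorphic.clm_comp y) (‖y‖ * ‖f‖)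
        fun x => (y.le_opNorm _).trans
          (mul_le_mul_of_nonneg_left (f.norm_toFun_le x) (norm_nonneg _))
      map_add' := fun _ _ => rfl
      map_smul' := fun _ _ => rfl } ‖f‖ fun y => by
    rw [mul_comm]
    exact HInf.norm_le _ (by positivity) fun x => (y.le_opNorm _).trans
      (mul_le_mul_of_nonneg_left (f.norm_toFun_le x) (norm_nonneg _))

@[simp] theorem HInf.transpose_apply {U : Opens E} (f : HInf U F) (y : StrongDual ℂ F) (x : U) :
    (f.transpose y).toFun x = y (f.toFun x) := rfl

theorem HInf.norm_transpose_apply_le {U : Opens E} (f : HInf U F) (y : StrongDual ℂ F) :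
    ‖f.transpose y‖ ≤ ‖f‖ * ‖y‖ :=
  f.transpose.le_of_opNorm_le (LinearMap.mkContinuous_norm_le _ (norm_nonneg _) _) y

theorem norm_le_of_dual_bound {v : F} {C : ℝ} (hC : 0 ≤ C)
    (h : ∀ y : StrongDual ℂ F, ‖y v‖ ≤ C * ‖y‖) : ‖v‖ ≤ C :=
  NormedSpace.norm_le_dual_bound ℂ v hC h

theorem eq_of_dual_eq {v w : F} (h : ∀ y : StrongDual ℂ F, y v = y w) : v = w := by
  rw [← sub_eq_zero, ← norm_le_zero_iff]
  exact norm_le_of_dual_bound le_rfl fun y => by simp [h y]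

/-- The functionals `φ ∈ H^∞(U)^*` for which there is a `v ∈ F` with `y*(v) = φ(y* ∘ f)` for all
`y* ∈ F^*`. -/
def HInf.representable {U : Opens E} (f : HInf U F) :
    Submodule ℂ (StrongDual ℂ (HInf U ℂ)) where
  carrier := {φ | ∃ v : F, ∀ y : StrongDual ℂ F, y v = φ (f.transpose y)}
  zero_mem' := ⟨0, fun y => by simp⟩
  add_mem' := fun ⟨v, hv⟩ ⟨w, hw⟩ => ⟨v + w, fun y => by simp [hv, hw]⟩
  smul_mem' := fun c _ ⟨v, hv⟩ => ⟨c • v, fun y => by simp [hv]⟩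

theorem HInf.norm_le_of_represents {U : Opens E} (f : HInf U F) {φ : StrongDual ℂ (HInf U ℂ)}
    {v : F} (h : ∀ y : StrongDual ℂ F, y v = φ (f.transpose y)) : ‖v‖ ≤ ‖f‖ * ‖φ‖ := by
  refine norm_le_of_dual_bound (by positivity) fun y => ?_
  rw [h y]
  calc ‖φ (f.transpose y)‖ ≤ ‖φ‖ * ‖f.transpose y‖ := φ.le_opNorm _
    _ ≤ ‖φ‖ * (‖f‖ * ‖y‖) := by
        gcongr
        exact f.norm_transpose_apply_le y
    _ = _ := by ring

theorem HInf.isClosed_representable [CompleteSpace F] {U : Opens E} (f : HInf U F) :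
    IsClosed (f.representable : Set (StrongDual ℂ (HInf U ℂ))) := by
  refine IsSeqClosed.isClosed fun u φ hu hlim => ?_
  choose v hv using hu
  have hcauchy : CauchySeq v := by
    have hu' : CauchySeq u := hlim.cauchySeq
    rw [Metric.cauchySeq_iff'] at hu' ⊢
    intro ε hε
    obtain ⟨N, hN⟩ := hu' (ε / (‖f‖ + 1)) (by positivity)
    refine ⟨N, fun n hn => ?_⟩
    have h1 := hN n hn
    rw [dist_eq_norm, lt_div_iff₀ (by positivity)] at h1
    rw [dist_eq_norm]
    have h2 : ‖v n - v N‖ ≤ ‖f‖ * ‖u n - u N‖ :=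
      f.norm_le_of_represents fun y => by simp [hv]
    nlinarith [norm_nonneg (u n - u N)]
  obtain ⟨w, hw⟩ := cauchySeq_tendsto_of_complete hcauchy
  refine ⟨w, fun y => ?_⟩
  have h1 : Filter.Tendsto (fun n => y (v n)) Filter.atTop (nhds (y w)) :=
    (y.continuous.tendsto w).comp hw
  have h2 : Filter.Tendsto (fun n => y (v n)) Filter.atTop (nhds (φ (f.transpose y))) := by
    simp only [hv]
    exact ((ContinuousLinearMap.apply ℂ ℂ (f.transpose y)).continuous.tendsto φ).comp hlim
  exact tendsto_nhds_unique h1 h2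

theorem HInf.exists_represents [CompleteSpace F] {U : Opens E} (f : HInf U F) (γ : GInf U) :
    ∃ v : F, ∀ y : StrongDual ℂ F, y v = γ.toDual (f.transpose y) := by
  have hle : gInfSubmodule U ≤ f.representable := by
    refine Submodule.topologicalClosure_minimal _ ?_ f.isClosed_representable
    rw [Submodule.span_le]
    rintro _ ⟨x, rfl⟩
    exact ⟨f.toFun x, fun y => rfl⟩
  exact hle γ.2

/-- Mujica's linearization `T_f : G^∞(U) → F` of `f ∈ H^∞(U, F)`: the element `T_f(γ)` of `F` is
the one with `y*(T_f(γ)) = γ(y* ∘ f)` for all `y* ∈ F^*`. It is the unique bounded operator with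
`T_f ∘ g_U = f`, see `linearization_gMap` and `linearization_unique`. -/
def linearization [CompleteSpace F] {U : Opens E} (f : HInf U F) : GInf U →L[ℂ] F :=
  LinearMap.mkContinuous
    { toFun := fun γ => (f.exists_represents γ).choose
      map_add' := fun γ δ => eq_of_dual_eq fun y => by
        rw [map_add, (f.exists_represents γ).choose_spec, (f.exists_represents δ).choose_spec,
          (f.exists_represents (γ + δ)).choose_spec]
        rfl
      map_smul' := fun c γ => eq_of_dual_eq fun y => by
        rw [RingHom.id_apply, map_smul, (f.exists_represents γ).choose_spec,
          (f.exists_represents (c • γ)).choose_spec]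
        rfl } ‖f‖
    fun γ => f.norm_le_of_represents (f.exists_represents γ).choose_spec

theorem linearization_spec [CompleteSpace F] {U : Opens E} (f : HInf U F) (γ : GInf U)
    (y : StrongDual ℂ F) : y (linearization f γ) = γ.toDual (f.transpose y) :=
  (f.exists_represents γ).choose_spec y

/-- `T_f ∘ g_U = f`. -/
theorem linearization_gMap [CompleteSpace F] {U : Opens E} (f : HInf U F) (x : U) :
    linearization f (gMap U x) = f.toFun x :=
  eq_of_dual_eq fun y => linearization_spec f (gMap U x) y

/-- `T_f` is the only bounded operator `T` with `T ∘ g_U = f`. -/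
theorem linearization_unique [CompleteSpace F] {U : Opens E} (f : HInf U F) (T : GInf U →L[ℂ] F)
    (hT : ∀ x, T (gMap U x) = f.toFun x) : T = linearization f := by
  have key : ∀ φ (hφ : φ ∈ Submodule.span ℂ (Set.range (evalFunctional U))),
      T (GInf.mk φ (mem_gInfSubmodule hφ)) =
        linearization f (GInf.mk φ (mem_gInfSubmodule hφ)) := by
    intro φ hφ
    induction hφ using Submodule.span_induction with
    | mem φ h =>
      obtain ⟨x, rfl⟩ := h
      exact (hT x).trans (linearization_gMap f x).symm
    | zero => exact (map_zero T).trans (map_zero (linearization f)).symm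
    | add φ ψ hφ hψ h1 h2 =>
      exact (map_add T (GInf.mk φ _) (GInf.mk ψ _)).trans ((congrArg₂ (· + ·) h1 h2).trans
        (map_add (linearization f) (GInf.mk φ _) (GInf.mk ψ _)).symm)
    | smul c φ hφ h1 =>
      exact (map_smul T c (GInf.mk φ _)).trans ((congrArg (c • ·) h1).trans
        (map_smul (linearization f) c (GInf.mk φ _)).symm)
  ext γ
  have hcl : IsClosed {γ : GInf U | T γ = linearization f γ} :=
    isClosed_eq T.continuous (linearization f).continuous
  have hγ : γ.toDual ∈ closure (Submodule.span ℂ (Set.range (evalFunctional U)) :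
      Set (StrongDual ℂ (HInf U ℂ))) := γ.2
  obtain ⟨u, hu, hlim⟩ := mem_closure_iff_seq_limit.1 hγ
  have hlim' : Filter.Tendsto
      (fun n => GInf.mk (u n) (mem_gInfSubmodule (hu n)))
      Filter.atTop (nhds γ) := by
    rw [tendsto_iff_norm_sub_tendsto_zero] at hlim ⊢
    exact hlim
  exact hcl.mem_of_tendsto hlim' (Filter.Eventually.of_forall fun n => key (u n) (hu n))

end HInf

/-! ### The best constant in a family of inequalities -/

/-- The infimum of the constants `C ≥ 0` with the property `B`. -/
def bestConst (B : ℝ → Prop) : ℝ := sInf {C : ℝ | 0 ≤ C ∧ B C}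

theorem bestConst_nonneg (B : ℝ → Prop) : 0 ≤ bestConst B :=
  Real.sInf_nonneg fun _ h => h.1

theorem bestConst_le {B : ℝ → Prop} {C : ℝ} (h0 : 0 ≤ C) (h : B C) : bestConst B ≤ C :=
  csInf_le ⟨0, fun _ h => h.1⟩ ⟨h0, h⟩

theorem le_bestConst_mul {B : ℝ → Prop} (hB : ∃ C, 0 ≤ C ∧ B C) {a r : ℝ} (hr : 0 ≤ r)
    (h : ∀ C, 0 ≤ C → B C → a ≤ C * r) : a ≤ bestConst B * r := by
  rcases hr.eq_or_lt with rfl | hr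
  · obtain ⟨C, h0, hC⟩ := hB
    simpa using h C h0 hC
  · rw [← div_le_iff₀ hr]
    exact le_csInf hB fun C hC => (div_le_iff₀ hr).2 (h C hC.1 hC.2)

/-! ### Strongly summing operators and Cohen strongly summing holomorphic mappings -/

section Summing

variable {E : Type*} {F : Type*} {X : Type*} [NormedAddCommGroup E] [NormedSpace ℂ E]
  [NormedAddCommGroup F] [NormedSpace ℂ F] [NormedAddCommGroup X] [NormedSpace ℂ X]

/-- The weak `ℓ_q`-norm of `y*_1, …, y*_n ∈ F^*`: the supremum over `y**` in the closed unit ball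
of `F^{**}` of the `ℓ_q`-norm of `(y**(y*_1), …, y**(y*_n))` (the maximum of the moduli if
`q = ∞`). -/
def weakLpNorm (q : ℝ≥0∞) {n : ℕ} (y : Fin n → StrongDual ℂ F) : ℝ :=
  ⨆ z : {z : StrongDual ℂ (StrongDual ℂ F) // ‖z‖ ≤ 1},
    ‖WithLp.toLp q fun i => z.1 (y i)‖

theorem piLp_norm_nonneg {Y : Type*} [NormedAddCommGroup Y] (p : ℝ≥0∞) [Fact (1 ≤ p)] {n : ℕ}
    (v : Fin n → Y) : 0 ≤ ‖WithLp.toLp p v‖ := norm_nonneg _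

theorem piLp_norm_one {Y : Type*} [NormedAddCommGroup Y] (p : ℝ≥0∞) [Fact (1 ≤ p)] (v : Y) :
    ‖WithLp.toLp p (fun _ : Fin 1 => v)‖ = ‖v‖ := by
  have h : (fun _ : Fin 1 => v) = Pi.single 0 v := by
    funext i
    fin_cases i
    simp
  rw [h]
  exact PiLp.norm_single p (fun _ : Fin 1 => Y) 0 v

theorem fact_one_le_conjExponent (p : ℝ≥0∞) : Fact (1 ≤ p.conjExponent) :=
  ⟨le_self_add⟩

theorem weakLpNorm_nonneg (p : ℝ≥0∞) {n : ℕ} (y : Fin n → StrongDual ℂ F) :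
    0 ≤ weakLpNorm p.conjExponent y := by
  have := fact_one_le_conjExponent p
  exact Real.iSup_nonneg fun _ => piLp_norm_nonneg _ _

theorem weakLpNorm_one_le (p : ℝ≥0∞) (y : StrongDual ℂ F) :
    weakLpNorm p.conjExponent (fun _ : Fin 1 => y) ≤ ‖y‖ := by
  have := fact_one_le_conjExponent p
  refine Real.iSup_le (fun z => ?_) (norm_nonneg _)
  rw [piLp_norm_one]
  exact (z.1.le_of_opNorm_le z.2 y).trans_eq (one_mul _)

/-! #### Operators -/

/-- The constant `C` satisfies the inequalities that define strongly `p`-summing operators: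
`∑ |⟨y*_i, T x_i⟩| ≤ C ‖(x_i)‖_{ℓ_p} sup_{y**} ‖(y**(y*_i))‖_{ℓ_{p*}}`. -/
def StrongBound (p : ℝ≥0∞) (T : X →L[ℂ] F) (C : ℝ) : Prop :=
  ∀ (n : ℕ) (x : Fin n → X) (y : Fin n → StrongDual ℂ F),
    ∑ i, ‖y i (T (x i))‖ ≤ C * ‖WithLp.toLp p x‖ * weakLpNorm p.conjExponent y

/-- `T` is strongly `p`-summing. -/
def IsStronglySumming (p : ℝ≥0∞) (T : X →L[ℂ] F) : Prop :=
  ∃ C : ℝ, 0 ≤ C ∧ StrongBound p T C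

/-- `d_p(T)`. -/
def strongConst (p : ℝ≥0∞) (T : X →L[ℂ] F) : ℝ := bestConst (StrongBound p T)

theorem StrongBound.zero (p : ℝ≥0∞) : StrongBound p (0 : X →L[ℂ] F) 0 := by
  intro n x y
  simp

theorem StrongBound.add {p : ℝ≥0∞} {S T : X →L[ℂ] F} {C D : ℝ} (hS : StrongBound p S C)
    (hT : StrongBound p T D) : StrongBound p (S + T) (C + D) := by
  intro n x y
  calc ∑ i, ‖y i ((S + T) (x i))‖ ≤ ∑ i, (‖y i (S (x i))‖ + ‖y i (T (x i))‖) := by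
        gcongr with i
        simpa using norm_add_le (y i (S (x i))) (y i (T (x i)))
    _ ≤ _ := by
        rw [Finset.sum_add_distrib, add_mul, add_mul]
        exact add_le_add (hS n x y) (hT n x y)

theorem StrongBound.smul {p : ℝ≥0∞} {T : X →L[ℂ] F} {C : ℝ} (c : ℂ) (hT : StrongBound p T C) :
    StrongBound p (c • T) (‖c‖ * C) := by
  intro n x y
  calc ∑ i, ‖y i ((c • T) (x i))‖ = ‖c‖ * ∑ i, ‖y i (T (x i))‖ := by
        simp [Finset.mul_sum]
    _ ≤ _ := by
        rw [mul_assoc, mul_assoc, ← mul_assoc C]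
        exact mul_le_mul_of_nonneg_left (hT n x y) (norm_nonneg _)

theorem IsStronglySumming.strongBound {p : ℝ≥0∞} [Fact (1 ≤ p)] {T : X →L[ℂ] F}
    (hT : IsStronglySumming p T) : StrongBound p T (strongConst p T) := by
  intro n x y
  rw [mul_assoc]
  exact le_bestConst_mul hT (mul_nonneg (piLp_norm_nonneg _ _) (weakLpNorm_nonneg _ _))
    fun C _ hC => by
      rw [← mul_assoc]
      exact hC n x y

theorem StrongBound.norm_le {p : ℝ≥0∞} [Fact (1 ≤ p)] {T : X →L[ℂ] F} {C : ℝ} (h0 : 0 ≤ C)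
    (hT : StrongBound p T C) (x : X) : ‖T x‖ ≤ C * ‖x‖ := by
  refine norm_le_of_dual_bound (by positivity) fun y => ?_
  have h := hT 1 (fun _ => x) (fun _ => y)
  rw [piLp_norm_one] at h
  simp only [Finset.univ_unique, Finset.sum_const, Finset.card_singleton, one_smul] at h
  exact h.trans (mul_le_mul_of_nonneg_left (weakLpNorm_one_le p y) (by positivity))

/-- The linear space `D_p(X, F)` of strongly `p`-summing operators. -/
def strongSubmodule (p : ℝ≥0∞) (X : Type*) (F : Type*) [NormedAddCommGroup X] [NormedSpace ℂ X]
    [NormedAddCommGroup F] [NormedSpace ℂ F] : Submodule ℂ (X →L[ℂ] F) where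
  carrier := {T | IsStronglySumming p T}
  zero_mem' := ⟨0, le_rfl, StrongBound.zero p⟩
  add_mem' := fun ⟨C, h0, hC⟩ ⟨D, h0', hD⟩ => ⟨C + D, add_nonneg h0 h0', hC.add hD⟩
  smul_mem' := fun c _ ⟨C, h0, hC⟩ => ⟨‖c‖ * C, by positivity, hC.smul c⟩

/-- The space `(D_p(X, F), d_p)` of strongly `p`-summing operators, with the norm `d_p` (and not
the operator norm). -/
def StrongSpace (p : ℝ≥0∞) (X : Type*) (F : Type*) [NormedAddCommGroup X] [NormedSpace ℂ X]
    [NormedAddCommGroup F] [NormedSpace ℂ F] : Type _ := strongSubmodule p X F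

namespace StrongSpace

instance (p : ℝ≥0∞) : AddCommGroup (StrongSpace p X F) :=
  inferInstanceAs (AddCommGroup (strongSubmodule p X F))

instance (p : ℝ≥0∞) : Module ℂ (StrongSpace p X F) :=
  inferInstanceAs (Module ℂ (strongSubmodule p X F))

/-- The bounded operator that an element of `D_p(X, F)` is. -/
def toCLM {p : ℝ≥0∞} (T : StrongSpace p X F) : X →L[ℂ] F := T.1

theorem isStronglySumming {p : ℝ≥0∞} (T : StrongSpace p X F) : IsStronglySumming p T.toCLM := T.2

instance (p : ℝ≥0∞) : Norm (StrongSpace p X F) := ⟨fun T => strongConst p T.toCLM⟩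

theorem norm_def {p : ℝ≥0∞} (T : StrongSpace p X F) : ‖T‖ = strongConst p T.toCLM := rfl

theorem normCore (p : ℝ≥0∞) [Fact (1 ≤ p)] : NormedSpace.Core ℂ (StrongSpace p X F) := by
  have hsmul : ∀ (c : ℂ) (T : StrongSpace p X F), ‖c • T‖ ≤ ‖c‖ * ‖T‖ := fun c T =>
    bestConst_le (mul_nonneg (norm_nonneg _) (bestConst_nonneg _))
      (T.isStronglySumming.strongBound.smul c)
  have hzero : ‖(0 : StrongSpace p X F)‖ = 0 :=
    le_antisymm (bestConst_le le_rfl (StrongBound.zero p)) (bestConst_nonneg _)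
  refine ⟨⟨fun T => bestConst_nonneg _, fun c T => ?_, fun S T => ?_⟩, fun T => ⟨fun h => ?_, ?_⟩⟩
  · refine le_antisymm (hsmul c T) ?_
    rcases eq_or_ne c 0 with rfl | hc
    · rw [norm_zero, zero_mul]
      exact bestConst_nonneg _
    · have h := hsmul c⁻¹ (c • T)
      rw [smul_smul, inv_mul_cancel₀ hc, one_smul, norm_inv] at h
      rwa [le_inv_mul_iff₀ (norm_pos_iff.2 hc)] at h
  · exact bestConst_le (add_nonneg (bestConst_nonneg _) (bestConst_nonneg _))
      (S.isStronglySumming.strongBound.add T.isStronglySumming.strongBound)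
  · have hb := T.isStronglySumming.strongBound
    rw [← norm_def, h] at hb
    apply Subtype.ext
    ext x
    have hx := hb.norm_le le_rfl x
    rw [zero_mul] at hx
    exact norm_le_zero_iff.1 hx
  · rintro rfl
    exact hzero

instance (p : ℝ≥0∞) [Fact (1 ≤ p)] : NormedAddCommGroup (StrongSpace p X F) :=
  NormedAddCommGroup.ofCore (normCore p)

instance (p : ℝ≥0∞) [Fact (1 ≤ p)] : NormedSpace ℂ (StrongSpace p X F) :=
  NormedSpace.ofCore (normCore p)

end StrongSpace

/-! #### Holomorphic mappings -/

/-- The constant `C` satisfies the inequalities that define Cohen strongly `p`-summing mappings: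
`∑ |λ_i| |⟨y*_i, f(x_i)⟩| ≤ C ‖(λ_i)‖_{ℓ_p} sup_{y**} ‖(y**(y*_i))‖_{ℓ_{p*}}`. -/
def CohenBound (p : ℝ≥0∞) {U : Opens E} (f : U → F) (C : ℝ) : Prop :=
  ∀ (n : ℕ) (c : Fin n → ℂ) (x : Fin n → U) (y : Fin n → StrongDual ℂ F),
    ∑ i, ‖c i‖ * ‖y i (f (x i))‖ ≤ C * ‖WithLp.toLp p c‖ * weakLpNorm p.conjExponent y

/-- `f : U → F` is a Cohen strongly `p`-summing holomorphic mapping. -/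
def IsCohenStronglySumming (p : ℝ≥0∞) {U : Opens E} (f : U → F) : Prop :=
  IsHolomorphic U f ∧ ∃ C : ℝ, 0 ≤ C ∧ CohenBound p f C

/-- `d_p^{H^∞}(f)`. -/
def cohenConst (p : ℝ≥0∞) {U : Opens E} (f : U → F) : ℝ := bestConst (CohenBound p f)

theorem CohenBound.zero (p : ℝ≥0∞) {U : Opens E} : CohenBound p (0 : U → F) 0 := by
  intro n c x y
  simp

theorem CohenBound.add {p : ℝ≥0∞} {U : Opens E} {f g : U → F} {C D : ℝ} (hf : CohenBound p f C)
    (hg : CohenBound p g D) : CohenBound p (f + g) (C + D) := by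
  intro n c x y
  calc ∑ i, ‖c i‖ * ‖y i ((f + g) (x i))‖
      ≤ ∑ i, (‖c i‖ * ‖y i (f (x i))‖ + ‖c i‖ * ‖y i (g (x i))‖) := by
        gcongr with i
        rw [← mul_add]
        gcongr
        simpa using norm_add_le (y i (f (x i))) (y i (g (x i)))
    _ ≤ _ := by
        rw [Finset.sum_add_distrib, add_mul, add_mul]
        exact add_le_add (hf n c x y) (hg n c x y)

theorem CohenBound.smul {p : ℝ≥0∞} {U : Opens E} {f : U → F} {C : ℝ} (a : ℂ)
    (hf : CohenBound p f C) : CohenBound p (a • f) (‖a‖ * C) := by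
  intro n c x y
  calc ∑ i, ‖c i‖ * ‖y i ((a • f) (x i))‖ = ‖a‖ * ∑ i, ‖c i‖ * ‖y i (f (x i))‖ := by
        rw [Finset.mul_sum]
        refine Finset.sum_congr rfl fun i _ => ?_
        simp only [Pi.smul_apply, map_smul, norm_smul]
        ring
    _ ≤ _ := by
        rw [mul_assoc, mul_assoc, ← mul_assoc C]
        exact mul_le_mul_of_nonneg_left (hf n c x y) (norm_nonneg _)

theorem IsCohenStronglySumming.cohenBound {p : ℝ≥0∞} [Fact (1 ≤ p)] {U : Opens E} {f : U → F}
    (hf : IsCohenStronglySumming p f) : CohenBound p f (cohenConst p f) := by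
  intro n c x y
  rw [mul_assoc]
  exact le_bestConst_mul hf.2 (mul_nonneg (piLp_norm_nonneg _ _) (weakLpNorm_nonneg _ _))
    fun C _ hC => by
      rw [← mul_assoc]
      exact hC n c x y

theorem CohenBound.norm_le {p : ℝ≥0∞} [Fact (1 ≤ p)] {U : Opens E} {f : U → F} {C : ℝ}
    (h0 : 0 ≤ C) (hf : CohenBound p f C) (x : U) : ‖f x‖ ≤ C := by
  refine norm_le_of_dual_bound h0 fun y => ?_
  have h := hf 1 (fun _ => 1) (fun _ => x) (fun _ => y)
  rw [piLp_norm_one] at h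
  simp only [Finset.univ_unique, Finset.sum_const, Finset.card_singleton, one_smul, norm_one,
    one_mul, mul_one] at h
  exact h.trans (mul_le_mul_of_nonneg_left (weakLpNorm_one_le p y) h0)

/-- The linear space `D_p^{H^∞}(U, F)` of all Cohen strongly `p`-summing holomorphic mappings. -/
def cohenSubmodule (p : ℝ≥0∞) (U : Opens E) (F : Type*) [NormedAddCommGroup F]
    [NormedSpace ℂ F] : Submodule ℂ (U → F) where
  carrier := {f | IsCohenStronglySumming p f}
  zero_mem' := ⟨IsHolomorphic.zero U, 0, le_rfl, CohenBound.zero p⟩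
  add_mem' := fun ⟨h, C, h0, hC⟩ ⟨h', D, h0', hD⟩ => ⟨h.add h', C + D, add_nonneg h0 h0', hC.add hD⟩
  smul_mem' := fun c _ ⟨h, C, h0, hC⟩ => ⟨h.smul c, ‖c‖ * C, by positivity, hC.smul c⟩

/-- The space `(D_p^{H^∞}(U, F), d_p^{H^∞})` of Cohen strongly `p`-summing holomorphic mappings,
with the norm `d_p^{H^∞}`. -/
def CohenSpace (p : ℝ≥0∞) (U : Opens E) (F : Type*) [NormedAddCommGroup F]
    [NormedSpace ℂ F] : Type _ := cohenSubmodule p U F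

namespace CohenSpace

instance (p : ℝ≥0∞) (U : Opens E) : AddCommGroup (CohenSpace p U F) :=
  inferInstanceAs (AddCommGroup (cohenSubmodule p U F))

instance (p : ℝ≥0∞) (U : Opens E) : Module ℂ (CohenSpace p U F) :=
  inferInstanceAs (Module ℂ (cohenSubmodule p U F))

/-- The mapping `U → F` that an element of `D_p^{H^∞}(U, F)` is. -/
def toFun {p : ℝ≥0∞} {U : Opens E} (f : CohenSpace p U F) : U → F := f.1

theorem isCohenStronglySumming {p : ℝ≥0∞} {U : Opens E} (f : CohenSpace p U F) :
    IsCohenStronglySumming p f.toFun := f.2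

/-- Cohen strongly `p`-summing holomorphic mappings are bounded: the inclusion of
`D_p^{H^∞}(U, F)` in `H^∞(U, F)`. -/
def toHInf {p : ℝ≥0∞} [Fact (1 ≤ p)] {U : Opens E} (f : CohenSpace p U F) : HInf U F :=
  HInf.mk f.toFun f.isCohenStronglySumming.1 (cohenConst p f.toFun)
    (f.isCohenStronglySumming.cohenBound.norm_le (bestConst_nonneg _))

instance (p : ℝ≥0∞) (U : Opens E) : Norm (CohenSpace p U F) := ⟨fun f => cohenConst p f.toFun⟩

theorem norm_def {p : ℝ≥0∞} {U : Opens E} (f : CohenSpace p U F) :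
    ‖f‖ = cohenConst p f.toFun := rfl

theorem normCore (p : ℝ≥0∞) [Fact (1 ≤ p)] (U : Opens E) :
    NormedSpace.Core ℂ (CohenSpace p U F) := by
  have hsmul : ∀ (c : ℂ) (f : CohenSpace p U F), ‖c • f‖ ≤ ‖c‖ * ‖f‖ := fun c f =>
    bestConst_le (mul_nonneg (norm_nonneg _) (bestConst_nonneg _))
      (f.isCohenStronglySumming.cohenBound.smul c)
  have hzero : ‖(0 : CohenSpace p U F)‖ = 0 :=
    le_antisymm (bestConst_le le_rfl (CohenBound.zero p)) (bestConst_nonneg _)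
  refine ⟨⟨fun f => bestConst_nonneg _, fun c f => ?_, fun f g => ?_⟩, fun f => ⟨fun h => ?_, ?_⟩⟩
  · refine le_antisymm (hsmul c f) ?_
    rcases eq_or_ne c 0 with rfl | hc
    · rw [norm_zero, zero_mul]
      exact bestConst_nonneg _
    · have h := hsmul c⁻¹ (c • f)
      rw [smul_smul, inv_mul_cancel₀ hc, one_smul, norm_inv] at h
      rwa [le_inv_mul_iff₀ (norm_pos_iff.2 hc)] at h
  · exact bestConst_le (add_nonneg (bestConst_nonneg _) (bestConst_nonneg _))
      (f.isCohenStronglySumming.cohenBound.add g.isCohenStronglySumming.cohenBound)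
  · have hb := f.isCohenStronglySumming.cohenBound
    rw [← norm_def, h] at hb
    apply Subtype.ext
    funext x
    exact norm_le_zero_iff.1 (hb.norm_le le_rfl x)
  · rintro rfl
    exact hzero

instance (p : ℝ≥0∞) [Fact (1 ≤ p)] (U : Opens E) : NormedAddCommGroup (CohenSpace p U F) :=
  NormedAddCommGroup.ofCore (normCore p U)

instance (p : ℝ≥0∞) [Fact (1 ≤ p)] (U : Opens E) : NormedSpace ℂ (CohenSpace p U F) :=
  NormedSpace.ofCore (normCore p U)

end CohenSpace

end Summing

end

open scoped ENNReal BoundedContinuousFunction Topology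
open TopologicalSpace

/-! ### Cauchy estimates -/

section Cauchy

variable {E : Type*} {F : Type*} [NormedAddCommGroup E] [NormedSpace ℂ E]
  [NormedAddCommGroup F] [NormedSpace ℂ F]

/-! A constant `C ≥ 0` is admissible for `f` exactly when it is admissible for `T_f`
(`strongBound_linearization_iff`); the equivalence and the equality of the two infima follow at
once. From `T_f` to `f`, test on the vectors `λ_i δ(x_i)`, whose norms are at most `|λ_i|`. From `f`
to `T_f`, use `y*(T_f γ) = γ(y* ∘ f)`, so that `|y*(T_f γ)| ≤ ‖γ‖ ‖y* ∘ f‖_∞`. The supremum is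
nearly attained at a point of `U`, and the inequality for `f` with coefficients `‖γ_i‖` at such
points gives the claim up to an arbitrarily small error. No approximation of `γ` by combinations of
evaluations is needed. Surjectivity of `f ↦ T_f` requires `T ∘ g_U` to be holomorphic, hence
holomorphy of `g_U` (`isHolomorphic_gMap`). Cauchy estimates bound the Taylor remainder of every `g
∈ H^∞(U)` at `x` by a multiple of `‖g‖ ‖z - x‖²`. The multiple does not depend on `g`, so the
pointwise derivatives assemble into a derivative in the norm of `H^∞(U)^*`. -/

theorem norm_fderiv_le_of_norm_le_on_ball {f : E → F} {c : E} {R M : ℝ} (hR : 0 < R)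
    (hd : DifferentiableOn ℂ f (Metric.ball c R)) (hM : ∀ z ∈ Metric.ball c R, ‖f z‖ ≤ M) :
    ‖fderiv ℂ f c‖ ≤ 2 * M / R := by
  -- The ball is mapped into the closed ball of radius `2 * M` about `f c`, not about `0`; hence the
  -- factor 2.
  refine Complex.norm_fderiv_le_div_of_mapsTo_ball hd (fun z hz => ?_) hR
  rw [mem_closedBall_iff_norm]
  linarith [norm_sub_le (f z) (f c), hM z hz, hM c (Metric.mem_ball_self hR)]

/-- Higher-order Schwarz lemma for the first-order Taylor remainder. The bound depends on `f` only
through `M`, which makes it uniform over bounded sets of functions. -/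
theorem norm_sub_sub_fderiv_le_of_norm_le_on_ball {f : E → F} {c : E} {R M : ℝ} (hR : 0 < R)
    (hd : DifferentiableOn ℂ f (Metric.ball c R)) (hM : ∀ z ∈ Metric.ball c R, ‖f z‖ ≤ M)
    {z : E} (hz : z ∈ Metric.ball c R) :
    ‖f z - f c - fderiv ℂ f c (z - c)‖ ≤ 4 * M * (‖z - c‖ / R) ^ 2 := by
  have hc := hM c (Metric.mem_ball_self hR)
  have hφ : DifferentiableOn ℂ (fun w => f w - f c - fderiv ℂ f c (w - c)) (Metric.ball c R) := by
    fun_prop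
  -- The remainder is `o(‖w - c‖)`, so `n = 1` yields the exponent 2. The radius `4 * M` is `2 * M`
  -- for `f w - f c` plus `2 * M` for the linear term.
  have h := Complex.dist_le_mul_div_pow_of_mapsTo_ball_of_isLittleO (n := 1) (R₂ := 4 * M) hφ
    (fun w hw => ?_) ?_ hz
  · simpa [dist_eq_norm] using h
  · simp only [sub_self, map_zero, mem_closedBall_zero_iff]
    have h1 : ‖fderiv ℂ f c (w - c)‖ ≤ 2 * M := by
      calc ‖fderiv ℂ f c (w - c)‖ ≤ ‖fderiv ℂ f c‖ * ‖w - c‖ := (fderiv ℂ f c).le_opNorm _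
        _ ≤ 2 * M / R * R := mul_le_mul (norm_fderiv_le_of_norm_le_on_ball hR hd hM)
            (mem_ball_iff_norm.1 hw).le (norm_nonneg _)
            (div_nonneg (by linarith [norm_nonneg (f c)]) hR.le)
        _ = 2 * M := div_mul_cancel₀ _ hR.ne'
    linarith [norm_sub_le (f w - f c) (fderiv ℂ f c (w - c)), norm_sub_le (f w) (f c), hM w hw]
  · simpa using (hd.differentiableAt (Metric.ball_mem_nhds c hR)).hasFDerivAt.isLittleO.norm_right

end Cauchy

/-! ### Holomorphy of `x ↦ δ(x)` -/

section GMap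

variable {E : Type*} {F : Type*} [NormedAddCommGroup E] [NormedSpace ℂ E]
  [NormedAddCommGroup F] [NormedSpace ℂ F]

open Classical in
/-- The extension of `g_U` to `E` by `0`. -/
noncomputable def gMapExt (U : Opens E) (z : E) : GInf U :=
  if h : z ∈ U then gMap U ⟨z, h⟩ else 0

theorem gMapExt_coe (U : Opens E) (x : U) : gMapExt U x = gMap U x := by
  simp [gMapExt]

theorem gMapExt_toDual_apply {U : Opens E} (g : HInf U ℂ) (x : U) :
    (gMapExt U (x : E)).toDual g = g.toFun x := by
  rw [gMapExt_coe]
  rfl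

theorem norm_gMap_le (U : Opens E) (x : U) : ‖gMap U x‖ ≤ 1 :=
  (evalFunctional U x).opNorm_le_bound zero_le_one fun g => by
    rw [one_mul]
    exact g.norm_toFun_le x

theorem differentiableOn_gMapExt_toDual_apply {U : Opens E} (g : HInf U ℂ) :
    DifferentiableOn ℂ (fun z => (gMapExt U z).toDual g) U := by
  obtain ⟨g', hg', h⟩ := g.isHolomorphic
  exact hg'.congr fun z hz => (gMapExt_toDual_apply g ⟨z, hz⟩).trans (h ⟨z, hz⟩).symm

theorem norm_gMapExt_toDual_apply_le {U : Opens E} (g : HInf U ℂ) {z : E} (hz : z ∈ U) :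
    ‖(gMapExt U z).toDual g‖ ≤ ‖g‖ :=
  (congrArg norm (gMapExt_toDual_apply g ⟨z, hz⟩)).trans_le (g.norm_toFun_le _)

/-- The derivative must be `h ↦ (g ↦ Dg(x) h)`. Both its boundedness and the remainder estimate are
linear in `‖g‖`, so they are estimates in the dual norm. -/
theorem exists_hasFDerivAt_gMapExt_toDual (U : Opens E) (x : U) :
    ∃ L : E →L[ℂ] StrongDual ℂ (HInf U ℂ),
      HasFDerivAt (fun z => (gMapExt U z).toDual) L (x : E) := by
  obtain ⟨R, hR, hball⟩ := Metric.isOpen_iff.1 U.isOpen x x.2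
  have hd (g : HInf U ℂ) := (differentiableOn_gMapExt_toDual_apply g).mono hball
  have hM (g : HInf U ℂ) : ∀ z ∈ Metric.ball (x : E) R, ‖(gMapExt U z).toDual g‖ ≤ ‖g‖ :=
    fun z hz => norm_gMapExt_toDual_apply_le g (hball hz)
  have hda (g : HInf U ℂ) : DifferentiableAt ℂ (fun z => (gMapExt U z).toDual g) (x : E) :=
    (hd g).differentiableAt (Metric.ball_mem_nhds _ hR)
  let L : E →L[ℂ] StrongDual ℂ (HInf U ℂ) := LinearMap.mkContinuous₂
    (LinearMap.mk₂ ℂ (fun h g => fderiv ℂ (fun z => (gMapExt U z).toDual g) (x : E) h)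
      (fun _ _ _ => map_add _ _ _) (fun _ _ _ => map_smul _ _ _)
      (fun h g₁ g₂ => by
        simp only [map_add]
        rw [fderiv_fun_add (hda g₁) (hda g₂)]
        rfl)
      (fun c h g => by
        simp only [map_smul]
        rw [fderiv_fun_const_smul (hda g)]
        rfl)) (2 / R) fun h g => by
    calc _ ≤ 2 * ‖g‖ / R * ‖h‖ := ContinuousLinearMap.le_of_opNorm_le _
          (norm_fderiv_le_of_norm_le_on_ball hR (hd g) (hM g)) h
      _ = 2 / R * ‖h‖ * ‖g‖ := by ring
  refine ⟨L, .of_isLittleO ?_⟩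
  -- Evaluated at `g`, this is the Taylor remainder of `g`, so the preceding Cauchy estimate applies
  -- with `M = ‖g‖`.
  have hO : (fun z => (gMapExt U z).toDual - (gMapExt U (x : E)).toDual - L (z - x))
      =O[𝓝 (x : E)] fun z => ‖z - x‖ ^ 2 := by
    refine Asymptotics.IsBigO.of_bound (4 / R ^ 2) ?_
    filter_upwards [Metric.ball_mem_nhds (x : E) hR] with z hz
    refine ContinuousLinearMap.opNorm_le_bound _ (by positivity) fun g => ?_
    refine (norm_sub_sub_fderiv_le_of_norm_le_on_ball hR (hd g) (hM g) hz).trans_eq ?_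
    rw [norm_pow, norm_norm]
    ring
  refine hO.trans_isLittleO ?_
  have h1 : (fun h : E => ‖h‖ ^ 2) =o[𝓝 0] fun h : E => h :=
    Asymptotics.isLittleO_norm_pow_id one_lt_two
  have h2 : Filter.Tendsto (fun z : E => z - x) (𝓝 (x : E)) (𝓝 0) :=
    Continuous.tendsto' (by fun_prop) _ _ (sub_self _)
  exact h1.comp_tendsto h2

/-- Directional derivatives are limits of difference quotients, which stay in `S`. -/
theorem HasFDerivAt.apply_mem_of_isClosed_submodule {f : E → F} {L : E →L[ℂ] F} {x : E}
    (hf : HasFDerivAt f L x) {S : Submodule ℂ F} (hS : IsClosed (S : Set F)) (h : ∀ z, f z ∈ S)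
    (v : E) : L v ∈ S := by
  have hlim := (hf.hasLineDerivAt v).tendsto_slope_zero
  exact hS.mem_of_tendsto hlim (Filter.Eventually.of_forall fun t =>
    S.smul_mem _ (S.sub_mem (h _) (h _)))

theorem exists_hasFDerivAt_gMapExt (U : Opens E) (x : U) :
    ∃ L : E →L[ℂ] GInf U, HasFDerivAt (gMapExt U) L (x : E) := by
  obtain ⟨L, hL⟩ := exists_hasFDerivAt_gMapExt_toDual U x
  have hmem (v : E) : L v ∈ gInfSubmodule U := hL.apply_mem_of_isClosed_submodule
    (Submodule.isClosed_topologicalClosure _) (fun z => (gMapExt U z).toDual_mem) v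
  let L' : E →L[ℂ] GInf U := L.codRestrict (gInfSubmodule U) hmem
  refine ⟨L', .of_isLittleO ?_⟩
  -- `G^∞(U)` carries the norm of `H^∞(U)^*`, so the remainders in the two spaces have the same
  -- norms.
  exact Asymptotics.isLittleO_norm_left.1 hL.isLittleO.norm_left

theorem isHolomorphic_gMap (U : Opens E) : IsHolomorphic U (gMap U) := by
  refine ⟨gMapExt U, fun x hx => ?_, gMapExt_coe U⟩
  obtain ⟨L, hL⟩ := exists_hasFDerivAt_gMapExt U ⟨x, hx⟩
  exact hL.differentiableAt.differentiableWithinAt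

end GMap

/-! ### Strongly summing linearizations -/

section Linearization

variable {E : Type*} {F : Type*} [NormedAddCommGroup E] [NormedSpace ℂ E]
  [NormedAddCommGroup F] [NormedSpace ℂ F]

/-- The two spaces differ because tuples in `G^∞(U)` are compared with tuples of scalars. -/
theorem piLp_norm_le_of_forall_norm_le {X Y : Type*} [NormedAddCommGroup X]
    [NormedAddCommGroup Y] (p : ℝ≥0∞) [hp : Fact (1 ≤ p)] {n : ℕ} {v : Fin n → X} {w : Fin n → Y}
    (h : ∀ i, ‖v i‖ ≤ ‖w i‖) : ‖WithLp.toLp p v‖ ≤ ‖WithLp.toLp p w‖ := by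
  rcases eq_or_ne p ∞ with rfl | hp'
  · rw [PiLp.norm_eq_ciSup, PiLp.norm_eq_ciSup]
    exact ciSup_mono (Set.finite_range _).bddAbove h
  · have hpos : 0 < p.toReal := ENNReal.toReal_pos (one_pos.trans_le hp.out).ne' hp'
    rw [PiLp.norm_eq_sum hpos, PiLp.norm_eq_sum hpos]
    gcongr with i
    exact h i

theorem HInf.exists_norm_le_norm_toFun_add {U : Opens E} [Nonempty U] (g : HInf U F) {ε : ℝ}
    (hε : 0 < ε) : ∃ x : U, ‖g‖ ≤ ‖g.toFun x‖ + ε := by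
  by_contra! h
  obtain ⟨x⟩ := ‹Nonempty U›
  -- The point of `U` serves to show that the candidate bound `‖g‖ - ε` is nonnegative.
  have h0 : 0 ≤ ‖g‖ - ε := by linarith [h x, norm_nonneg (g.toFun x)]
  linarith [g.norm_le h0 fun x => by linarith [h x]]

theorem StrongBound.cohenBound {p : ℝ≥0∞} [Fact (1 ≤ p)] {U : Opens E} {T : GInf U →L[ℂ] F}
    {C : ℝ} (h0 : 0 ≤ C) (hT : StrongBound p T C) : CohenBound p (fun x => T (gMap U x)) C := by
  intro n c x y
  calc ∑ i, ‖c i‖ * ‖y i (T (gMap U (x i)))‖ = ∑ i, ‖y i (T (c i • gMap U (x i)))‖ := by simp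
    _ ≤ C * ‖WithLp.toLp p fun i => c i • gMap U (x i)‖ * weakLpNorm p.conjExponent y := hT n _ y
    _ ≤ _ := by
      refine mul_le_mul_of_nonneg_right (mul_le_mul_of_nonneg_left
        (piLp_norm_le_of_forall_norm_le p fun i => ?_) h0) (weakLpNorm_nonneg p y)
      rw [norm_smul]
      exact mul_le_of_le_one_right (norm_nonneg _) (norm_gMap_le U _)

/-- Each `γ i` acts on `y i ∘ f` by at most its norm times a supremum over `U`, and the inequality
for `f` controls the values at points that nearly attain these suprema. -/
theorem CohenBound.strongBound [CompleteSpace F] {p : ℝ≥0∞} [Fact (1 ≤ p)] {U : Opens E}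
    {f : HInf U F} {C : ℝ} (h0 : 0 ≤ C) (hf : CohenBound p f.toFun C) :
    StrongBound p (linearization f) C := by
  intro n γ y
  have hle : ∑ i, ‖y i (linearization f (γ i))‖ ≤ ∑ i, ‖γ i‖ * ‖f.transpose (y i)‖ := by
    gcongr with i
    rw [linearization_spec]
    exact (γ i).toDual.le_opNorm _
  refine hle.trans ?_
  -- Over an empty `U` there are no points to choose, but every norm in `H^∞(U)` vanishes.
  rcases isEmpty_or_nonempty U with hU | hU
  · have hz (i) : ‖f.transpose (y i)‖ = 0 :=
      le_antisymm (HInf.norm_le _ le_rfl fun x => hU.elim x) (norm_nonneg _)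
    simp only [hz, mul_zero, Finset.sum_const_zero]
    exact mul_nonneg (mul_nonneg h0 (piLp_norm_nonneg p γ)) (weakLpNorm_nonneg p y)
  have hε (ε : ℝ) (hε : 0 < ε) : ∑ i, ‖γ i‖ * ‖f.transpose (y i)‖ ≤
      C * ‖WithLp.toLp p γ‖ * weakLpNorm p.conjExponent y + ε * ∑ i, ‖γ i‖ := by
    choose x hx using fun i => (f.transpose (y i)).exists_norm_le_norm_toFun_add hε
    -- The coefficients `λ_i = ‖γ i‖` have the same `ℓ_p`-norm as the tuple `γ`, so no constant is
    -- lost.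
    have hc := hf n (fun i => (‖γ i‖ : ℂ)) x y
    have hn : ‖WithLp.toLp p fun i => (‖γ i‖ : ℂ)‖ ≤ ‖WithLp.toLp p γ‖ :=
      piLp_norm_le_of_forall_norm_le p fun i => by simp
    calc ∑ i, ‖γ i‖ * ‖f.transpose (y i)‖
        ≤ ∑ i, (‖(‖γ i‖ : ℂ)‖ * ‖y i (f.toFun (x i))‖ + ε * ‖γ i‖) := by
          gcongr with i
          rw [Complex.norm_real, norm_norm, mul_comm ε, ← mul_add]
          exact mul_le_mul_of_nonneg_left (hx i) (norm_nonneg _)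
      _ ≤ _ := by
          rw [Finset.sum_add_distrib, ← Finset.mul_sum]
          refine add_le_add_left (hc.trans ?_) _
          exact mul_le_mul_of_nonneg_right (mul_le_mul_of_nonneg_left hn h0)
            (weakLpNorm_nonneg p y)
  have hlim : Filter.Tendsto (fun ε : ℝ => C * ‖WithLp.toLp p γ‖ * weakLpNorm p.conjExponent y +
      ε * ∑ i, ‖γ i‖) (𝓝[>] 0) (𝓝 (C * ‖WithLp.toLp p γ‖ * weakLpNorm p.conjExponent y)) :=
    (Continuous.tendsto' (by fun_prop) _ _ (by simp)).mono_left nhdsWithin_le_nhds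
  exact ge_of_tendsto hlim (by filter_upwards [self_mem_nhdsWithin] with ε h using hε ε h)

theorem strongBound_linearization_iff [CompleteSpace F] {p : ℝ≥0∞} [Fact (1 ≤ p)] {U : Opens E}
    (f : HInf U F) {C : ℝ} (h0 : 0 ≤ C) :
    StrongBound p (linearization f) C ↔ CohenBound p f.toFun C := by
  refine ⟨fun h => ?_, CohenBound.strongBound h0⟩
  simpa only [linearization_gMap] using h.cohenBound h0

theorem isCohenStronglySumming_iff_linearization [CompleteSpace F] {p : ℝ≥0∞} [Fact (1 ≤ p)]
    {U : Opens E} (f : HInf U F) :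
    IsCohenStronglySumming p f.toFun ↔ IsStronglySumming p (linearization f) := by
  rw [IsCohenStronglySumming, and_iff_right f.isHolomorphic]
  exact exists_congr fun C => and_congr_right fun h0 => (strongBound_linearization_iff f h0).symm

theorem strongConst_linearization [CompleteSpace F] {p : ℝ≥0∞} [Fact (1 ≤ p)] {U : Opens E}
    (f : HInf U F) : strongConst p (linearization f) = cohenConst p f.toFun := by
  -- The sets of admissible constants coincide, so the infima agree even when both sets are empty.
  refine congrArg sInf (Set.ext fun C => ?_)
  exact and_congr_right fun h0 => strongBound_linearization_iff f h0

/-- `T ∘ g_U` as an element of `D_p^{H^∞}(U, F)`, for a strongly `p`-summing operator `T` on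
`G^∞(U)`. -/
noncomputable def StrongSpace.compGMap {p : ℝ≥0∞} [Fact (1 ≤ p)] {U : Opens E}
    (T : StrongSpace p (GInf U) F) : CohenSpace p U F :=
  -- The only place where holomorphy of `g_U` enters.
  ⟨fun x => T.toCLM (gMap U x), (isHolomorphic_gMap U).clm_comp T.toCLM, by
    obtain ⟨C, h0, hC⟩ := T.isStronglySumming
    exact ⟨C, h0, hC.cohenBound h0⟩⟩

theorem StrongSpace.linearization_compGMap [CompleteSpace F] {p : ℝ≥0∞} [Fact (1 ≤ p)]
    {U : Opens E} (T : StrongSpace p (GInf U) F) :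
    linearization T.compGMap.toHInf = T.toCLM :=
  (linearization_unique _ _ fun _ => rfl).symm

/-- The isometric isomorphism `f ↦ T_f` from `D_p^{H^∞}(U, F)` onto `D_p(G^∞(U), F)`. -/
noncomputable def linearizationEquiv (p : ℝ≥0∞) [Fact (1 ≤ p)] (U : Opens E) (F : Type*)
    [NormedAddCommGroup F] [NormedSpace ℂ F] [CompleteSpace F] :
    CohenSpace p U F ≃ₗᵢ[ℂ] StrongSpace p (GInf U) F where
  toFun f := ⟨linearization f.toHInf,
    (isCohenStronglySumming_iff_linearization f.toHInf).1 f.isCohenStronglySumming⟩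
  invFun T := T.compGMap
  -- `T_f + T_g` takes the value `f(x) + g(x)` at `δ(x)`, so it is the linearization of `f + g` by
  -- uniqueness.
  map_add' f g := Subtype.ext <| Eq.symm <| linearization_unique _ _ fun x =>
    congrArg₂ (· + ·) (linearization_gMap f.toHInf x) (linearization_gMap g.toHInf x)
  map_smul' c f := Subtype.ext <| Eq.symm <| linearization_unique _ _ fun x =>
    congrArg (c • ·) (linearization_gMap f.toHInf x)
  left_inv f := Subtype.ext <| funext fun x => linearization_gMap f.toHInf x
  right_inv T := Subtype.ext T.linearization_compGMap
  norm_map' f := strongConst_linearization f.toHInf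

end Linearization


theorem mainTheorem4 {E : Type*} [NormedAddCommGroup E] [NormedSpace ℂ E] [CompleteSpace E]
    {F : Type*} [NormedAddCommGroup F] [NormedSpace ℂ F] [CompleteSpace F]
    (U : Opens E) (p : ℝ≥0∞) [Fact (1 ≤ p)] (hp : 1 < p) :
    (∀ f : HInf U F,
      (IsCohenStronglySumming p f.toFun ↔ IsStronglySumming p (linearization f)) ∧
      (IsCohenStronglySumming p f.toFun →
        strongConst p (linearization f) = cohenConst p f.toFun)) ∧
    ∃ Φ : CohenSpace p U F ≃ₗᵢ[ℂ] StrongSpace p (GInf U) F,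
      ∀ f : CohenSpace p U F, (Φ f).toCLM = linearization f.toHInf := by
  exact ⟨fun f => ⟨isCohenStronglySumming_iff_linearization f,
    fun _ => strongConst_linearization f⟩, linearizationEquiv p U F, fun _ => rfl⟩
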